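/- Write $\omega=\{0,1,2,\dots\}$ and $[\omega]^2$ for the set of unordered pairs of elements of $\omega$. For infinite $D\subseteq\omega$ put $FS(D)=\{\sum_{n\in\alpha}n:\emptyset\ne\alpha\subseteq D \text{ finite}\}$, $r(D)=[D]^2$, $\Delta(D)=\{a-b:a,b\in D,\ a>b\}$. For $\rho\in\{FS,r,\Delta\}$ let $\Lambda_\rho$ be $\omega$, $[\omega]^2$, $\omega$ respectively, and let $\mathcal I_\rho$ be the family of all $A\subseteq\Lambda_\rho$ such that $\rho(D)\not\subseteq A$ for every infinite $D\subseteq\omega$; put $\mathcal H=\mathcal I_{FS}$, $\mathcal R=\mathcal I_r$, $\mathcal D=\mathcal I_\Delta$. A topological space $X$ is a Hindman (Ramsey, differentially compact, resp.) space if, for $\rho=FS$ ($\rho=r$, $\rho=\Delta$, resp.), for every $f:\Lambda_\rho\to X$ there are an infinite $D\subseteq\omega$ and $x\in X$ such that every neighbourhood $U$ of $x$ satisfies $f[\rho(D\setminus K)]\subseteq U$ for some finite $K\subseteq\omega$. An ideal on a countably infinite set $\Lambda$ is a family of subsets of $\Lambda$ that is closed under subsets and finite unions, contains all finite subsets of $\Lambda$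 and does not contain $\Lambda$. A space $X$ is in $\mathrm{FinBW}(\mathcal I)$ (is an $\mathcal I$-space) if for every $f:\Lambda\to X$ there is $A\subseteq\Lambda$, $A\notin\mathcal I$, such that $f\restriction A$ converges. We write $\mathcal I_2\le_K\mathcal I_1$, for $\mathcal I_i$ a family of subsets of $\Lambda_i$, if there is $\varphi:\Lambda_1\to\Lambda_2$ with $\varphi[A]\notin\mathcal I_2$ for every $A\subseteq\Lambda_1$ with $A\notin\mathcal I_1$. Let $\mathcal I_{1/n}=\{A\subseteq\omega:\sum_{n\in A}\frac1{n+1}<\infty\}$. An almost disjoint family on $\omega$ is a family $\mathcal A$ of infinite subsets of $\omega$ such that any two distinct members have finite intersection. For infinite such $\mathcal A$, $\Psi(\mathcal A)=\omega\cup\mathcal A$ (disjoint union) carries the topology in which the points of $\omega$ are isolated and the basic neighbourhoods of $A\in\mathcal A$ are the sets $\{A\}\cup(A\setminus F)$ with $F$ finite, and $\Phi(\mathcal A)$ is the one-point compactification of $\Psi(\mathcal A)$. **Corollary.** Assume the continuum hypothesis. (1) Let $\mathcal I$ be an ideal on a countably infinite set. If $\mathcal I\not\le_K\mathcal H$ ($\mathcal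 I\not\le_K\mathcal R$, $\mathcal I\not\le_K\mathcal D$, resp.), then there is an infinite almost disjoint family $\mathcal A$ on $\omega$ such that $\Phi(\mathcal A)$ is a Hausdorff, compact, separable space of cardinality $\mathfrak c$ that is a Hindman (Ramsey, differentially compact, resp.) space and is not in $\mathrm{FinBW}(\mathcal I)$. (2) There is an infinite almost disjoint family $\mathcal A$ on $\omega$ such that $\Phi(\mathcal A)$ is a Hausdorff, compact, separable space of cardinality $\mathfrak c$ that is a Hindman (Ramsey, differentially compact, resp.) space and is not an $\mathcal I_{1/n}$-space. -/

import Mathlib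

open Set Filter Topology Cardinal

/-- `I` is an ideal on the set `Λ`: closed under subsets and finite unions, proper, and
containing all finite sets. -/
structure IsIdealOn {Λ : Type*} (I : Set (Set Λ)) : Prop where
  subset_mem : ∀ A B : Set Λ, A ⊆ B → B ∈ I → A ∈ I
  union_mem : ∀ A B : Set Λ, A ∈ I → B ∈ I → A ∪ B ∈ I
  univ_notMem : (Set.univ : Set Λ) ∉ I
  finite_mem : ∀ A : Set Λ, A.Finite → A ∈ I

/-- The Katetov order: `KatetovLE J I` says that `J` is below `I`, that is, some map of the
underlying sets sends every set outside `I` to a set outside `J`. -/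
def KatetovLE {Λ₂ Λ₁ : Type*} (J : Set (Set Λ₂)) (I : Set (Set Λ₁)) : Prop :=
  ∃ φ : Λ₁ → Λ₂, ∀ A : Set Λ₁, A ∉ I → φ '' A ∉ J

/-- `FS(D)`: all sums of finite nonempty sets of (distinct) elements of `D`. -/
def finiteSums (D : Set ℕ) : Set ℕ :=
  {n | ∃ α : Finset ℕ, α.Nonempty ∧ (α : Set ℕ) ⊆ D ∧ ∑ i ∈ α, i = n}

/-- The set `[ω]²` of all unordered pairs of natural numbers. -/
abbrev NatPair : Type := Set.powersetCard ℕ 2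

/-- `r(H) = [H]²`: all unordered pairs of elements of `H`. -/
def pairsOf (H : Set ℕ) : Set NatPair :=
  {s | (s.1 : Set ℕ) ⊆ H}

/-- `Δ(E)`: all positive differences of elements of `E`. -/
def posDifferences (E : Set ℕ) : Set ℕ :=
  {d | ∃ a ∈ E, ∃ b ∈ E, b < a ∧ a - b = d}

/-- For `ρ : [ω]^ω → [Λ]^ω` (only its values at infinite sets are used), the family of all
sets that contain no `ρ(D)` with `D` infinite. -/
def idealOf {Λ : Type*} (ρ : Set ℕ → Set Λ) : Set (Set Λ) :=
  {A | ∀ D : Set ℕ, D.Infinite → ¬ ρ D ⊆ A}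

/-- The Hindman ideal. -/
def hindmanIdeal : Set (Set ℕ) := idealOf finiteSums

/-- The Ramsey ideal. -/
def ramseyIdeal : Set (Set NatPair) := idealOf pairsOf

/-- The ideal `𝒟` of sets that contain no `Δ(E)` with `E` infinite. -/
def differenceIdeal : Set (Set ℕ) := idealOf posDifferences

/-- The summable ideal. -/
def summableIdeal : Set (Set ℕ) :=
  {A | Summable (fun n : A => 1 / (((n : ℕ) : ℝ) + 1))}

/-- `f ↾ ρ(D)` is `ρ`-convergent to `x`. -/
def RhoConverges {Λ X : Type*} [TopologicalSpace X] (ρ : Set ℕ → Set Λ) (f : Λ → X)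
    (D : Set ℕ) (x : X) : Prop :=
  ∀ U ∈ 𝓝 x, ∃ K : Set ℕ, K.Finite ∧ f '' ρ (D \ K) ⊆ U

/-- The class `FinBW(ρ)` for `ρ : [ω]^ω → [Λ]^ω`. -/
def FinBWRho {Λ : Type*} (ρ : Set ℕ → Set Λ) (X : Type*) [TopologicalSpace X] : Prop :=
  ∀ f : Λ → X, ∃ D : Set ℕ, D.Infinite ∧ ∃ x : X, RhoConverges ρ f D x

/-- Hindman spaces (`ρ`-convergence is here IP-convergence). -/
def IsHindmanSpace (X : Type*) [TopologicalSpace X] : Prop := FinBWRho finiteSums X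

/-- Ramsey spaces. -/
def IsRamseySpace (X : Type*) [TopologicalSpace X] : Prop := FinBWRho pairsOf X

/-- Differentially compact spaces. -/
def IsDifferentiallyCompact (X : Type*) [TopologicalSpace X] : Prop :=
  FinBWRho posDifferences X

/-- The class `FinBW(I)` for an ideal `I`: every sequence indexed by `Λ` has a convergent
subsequence indexed by a set outside `I`. -/
def FinBW {Λ : Type*} (I : Set (Set Λ)) (X : Type*) [TopologicalSpace X] : Prop :=
  ∀ f : Λ → X, ∃ A : Set Λ, A ∉ I ∧ ∃ x : X, Tendsto (fun a : A => f a) cofinite (𝓝 x)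

/-- Almost disjoint families on `ω`. -/
def IsAlmostDisjoint (𝒜 : Set (Set ℕ)) : Prop :=
  (∀ A ∈ 𝒜, A.Infinite) ∧ ∀ A ∈ 𝒜, ∀ B ∈ 𝒜, A ≠ B → (A ∩ B).Finite

/-- The underlying set `ω ∪ 𝒜` (a disjoint union) of the Mrowka space. -/
inductive MrowkaSpace (𝒜 : Set (Set ℕ)) : Type
  | nat (n : ℕ) : MrowkaSpace 𝒜
  | mem (A : 𝒜) : MrowkaSpace 𝒜

/-- The Mrowka topology: points of `ω` are isolated, and the basic neighbourhoods of `A ∈ 𝒜`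
are the sets `{A} ∪ (A \ F)` with `F` finite. -/
instance (𝒜 : Set (Set ℕ)) : TopologicalSpace (MrowkaSpace 𝒜) where
  IsOpen U := ∀ A : 𝒜, MrowkaSpace.mem A ∈ U →
    ∃ F : Set ℕ, F.Finite ∧ ∀ n ∈ (A : Set ℕ) \ F, MrowkaSpace.nat n ∈ U
  isOpen_univ := fun _ _ => ⟨∅, Set.finite_empty, fun _ _ => Set.mem_univ _⟩
  isOpen_inter := fun U V hU hV A hA => by
    obtain ⟨F, hF, hFU⟩ := hU A hA.1
    obtain ⟨G, hG, hGV⟩ := hV A hA.2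
    exact ⟨F ∪ G, hF.union hG, fun n hn =>
      ⟨hFU n ⟨hn.1, fun h => hn.2 (Or.inl h)⟩, hGV n ⟨hn.1, fun h => hn.2 (Or.inr h)⟩⟩⟩
  isOpen_sUnion := fun S hS A hA => by
    obtain ⟨U, hU, hAU⟩ := hA
    obtain ⟨F, hF, hFU⟩ := hS U hU A hAU
    exact ⟨F, hF, fun n hn => ⟨U, hU, hFU n hn⟩⟩

/-- `Φ(𝒜)`: the one-point compactification of the Mrowka space of `𝒜`. -/
abbrev FranklinSpace (𝒜 : Set (Set ℕ)) : Type := OnePoint (MrowkaSpace 𝒜)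

/-- `𝒜` is an infinite almost disjoint family on `ω` for which `Φ(𝒜)` is a Hausdorff, compact,
separable space of cardinality continuum. -/
def HasNiceFranklinSpace (𝒜 : Set (Set ℕ)) : Prop :=
  𝒜.Infinite ∧ IsAlmostDisjoint 𝒜 ∧ T2Space (FranklinSpace 𝒜) ∧
    CompactSpace (FranklinSpace 𝒜) ∧ TopologicalSpace.SeparableSpace (FranklinSpace 𝒜) ∧
    #(FranklinSpace 𝒜) = 𝔠

/-!
`ρ`-convergence is convergence along the filter generated by the sets `ρ (D \ K)`. For each of the
three maps `ρ`, every infinite set carries an ultrafilter (a product `v ⊗ v` for pairs and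
differences, an idempotent one for finite sums) such that any countably generated filter it refines
is refined by such a tail filter.

Under CH, enumerate in type `ω₁` all maps `Λ → ω` and all sets outside `I`, and choose pairwise
disjoint, countably generated filters on `ω`, each containing a member of `I`. For a map, the image
of the ultrafilter is principal, or refines an earlier filter, or can be enlarged to a new countably
generated filter disjoint from all earlier ones; as `I` is not below the ideal of `ρ`, some `ρ D` is
mapped into `I`, so that the new filter is admissible. For a set `A` outside `I`, countably many
admissible filters do not exhaust `A`, so some infinite `B ⊆ A` in `I` is almost disjoint from them.
These `B` form `𝒜`. The inclusion of `ω` into `Φ(𝒜)` converges along no set outside `I`, because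
such a set contains some `B ∈ 𝒜` but is not almost contained in it. The filters of the first kind
are disjoint from all `B`, hence converge to the point at infinity.

For the summable ideal, consider a map into `ω` as a map into the compact space `ℕ∞`, where it has
iterated limits along the ultrafilter. By fusion, every value on a suitable `ρ D` either equals the
value of the limit function at an initial segment of its arguments or is at least `2 ^ k`, where `k`
codes the arguments.
-/

section TailFilter

variable {Λ Γ : Type*} {ρ : Set ℕ → Set Λ}

/-- The filter generated by the sets `ρ (D \ K)` with `K` finite, for monotone `ρ`:
`ρ`-convergence of `f ↾ ρ D` is convergence of `f` along this filter. -/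
def tailFilter (ρ : Set ℕ → Set Λ) (D : Set ℕ) : Filter Λ := (cofinite ⊓ 𝓟 D).lift' ρ

theorem hasBasis_tailFilter (hρ : Monotone ρ) (D : Set ℕ) :
    (tailFilter ρ D).HasBasis Set.Finite fun K => ρ (D \ K) := by
  simpa only [tailFilter, Function.comp_def, ← sdiff_eq_compl_inter] using
    (hasBasis_cofinite.inf_principal D).lift' hρ

theorem isCountablyGenerated_tailFilter (hρ : Monotone ρ) (D : Set ℕ) :
    (tailFilter ρ D).IsCountablyGenerated :=
  HasCountableBasis.isCountablyGenerated ⟨hasBasis_tailFilter hρ D, Countable.ofPred_finite⟩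

theorem mem_tailFilter (hρ : Monotone ρ) (D : Set ℕ) : ρ D ∈ tailFilter ρ D := by
  simpa only [sdiff_empty] using (hasBasis_tailFilter hρ D).mem_of_mem finite_empty

theorem rhoConverges_iff_tendsto {X : Type*} [TopologicalSpace X] (hρ : Monotone ρ) {f : Λ → X}
    {D : Set ℕ} {x : X} : RhoConverges ρ f D x ↔ Tendsto f (tailFilter ρ D) (𝓝 x) := by
  simp only [RhoConverges, (hasBasis_tailFilter hρ D).tendsto_left_iff, mapsTo_iff_image_subset]

theorem map_tailFilter (hρ : Monotone ρ) (π : Λ → Γ) (D : Set ℕ) :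
    map π (tailFilter ρ D) = tailFilter (fun E => π '' ρ E) D :=
  map_lift'_eq hρ

/-- `f` converges, along the tail filter of some infinite set, to one of the filters in `𝒢`. -/
def HasTailLimitIn (ρ : Set ℕ → Set Λ) (f : Λ → Γ) (𝒢 : Set (Filter Γ)) : Prop :=
  ∃ D : Set ℕ, D.Infinite ∧ ∃ G ∈ 𝒢, Tendsto f (tailFilter ρ D) G

theorem HasTailLimitIn.comp {X : Type*} {f : Λ → Γ} {𝒢 : Set (Filter Γ)} {ℋ : Set (Filter X)}
    {g : Γ → X} (hf : HasTailLimitIn ρ f 𝒢) (hg : ∀ G ∈ 𝒢, ∃ H ∈ ℋ, Tendsto g G H) :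
    HasTailLimitIn ρ (g ∘ f) ℋ := by
  obtain ⟨D, hD, G, hG, hfG⟩ := hf
  obtain ⟨H, hH, hgH⟩ := hg G hG
  exact ⟨D, hD, H, hH, hgH.comp hfG⟩

theorem finBWRho_iff_hasTailLimitIn {X : Type*} [TopologicalSpace X] (hρ : Monotone ρ) :
    FinBWRho ρ X ↔ ∀ f : Λ → X, HasTailLimitIn ρ f (range 𝓝) := by
  simp only [FinBWRho, HasTailLimitIn, rhoConverges_iff_tendsto hρ, exists_range_iff]

theorem tailFilter_le_cofinite (hρ : Monotone ρ) {D : Set ℕ}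
    (h : ∀ x, ∃ K : Set ℕ, K.Finite ∧ x ∉ ρ (D \ K)) : tailFilter ρ D ≤ cofinite := by
  refine le_cofinite_iff_compl_singleton_mem.2 fun x => ?_
  obtain ⟨K, hK, hx⟩ := h x
  exact (hasBasis_tailFilter hρ D).mem_iff.2 ⟨K, hK, subset_compl_singleton_iff.2 hx⟩

/-- `ρ` is diagonalizable if it is a monotone map `[ω]^ω → [Λ]^ω` such that below every infinite
`E` there is an ultrafilter `p`, living on all the sets `ρ (E \ K)` with `K` finite, for which
every countable subfamily of `p` is met by some infinite `D`: each of its members contains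
`ρ (D \ K)` for a finite `K`. -/
structure IsDiagonalizable (ρ : Set ℕ → Set Λ) : Prop where
  monotone : Monotone ρ
  infinite : ∀ {D : Set ℕ}, D.Infinite → (ρ D).Infinite
  exists_ultrafilter : ∀ {E : Set ℕ}, E.Infinite → ∃ p : Ultrafilter Λ, ↑p ≤ tailFilter ρ E ∧
    ∀ l : Filter Λ, l.IsCountablyGenerated → ↑p ≤ l → ∃ D : Set ℕ, D.Infinite ∧ tailFilter ρ D ≤ l

theorem IsDiagonalizable.exists_ultrafilter_hasTailLimitIn (hρ : IsDiagonalizable ρ) {E : Set ℕ}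
    (hE : E.Infinite) : ∃ p : Ultrafilter Λ, ρ E ∈ p ∧ ∀ {Γ : Type*} {f : Λ → Γ}
      {𝒢 : Set (Filter Γ)}, ∀ l ∈ 𝒢, l.IsCountablyGenerated → Tendsto f p l →
        HasTailLimitIn ρ f 𝒢 := by
  obtain ⟨p, hpE, hp⟩ := hρ.exists_ultrafilter hE
  refine ⟨p, hpE (mem_tailFilter hρ.monotone E), fun {Γ f 𝒢} l hl𝒢 hl hfl => ?_⟩
  obtain ⟨D, hD, hDl⟩ := hp (comap f l) inferInstance (tendsto_iff_comap.1 hfl)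
  exact ⟨D, hD, l, hl𝒢, tendsto_iff_comap.2 hDl⟩

theorem IsDiagonalizable.image (hρ : IsDiagonalizable ρ) (π : Λ → Γ)
    (hπ : ∀ {D : Set ℕ}, D.Infinite → (π '' ρ D).Infinite) :
    IsDiagonalizable fun D => π '' ρ D where
  monotone _ _ h := image_mono (hρ.monotone h)
  infinite := hπ
  exists_ultrafilter hE := by
    obtain ⟨p, hpE, hp⟩ := hρ.exists_ultrafilter hE
    refine ⟨p.map π, ?_, fun l hl hpl => ?_⟩
    · rw [← map_tailFilter hρ.monotone]
      exact map_mono hpE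
    · obtain ⟨D, hD, hDl⟩ := hp (comap π l) inferInstance (map_le_iff_le_comap.1 hpl)
      refine ⟨D, hD, ?_⟩
      rw [← map_tailFilter hρ.monotone]
      exact map_le_iff_le_comap.2 hDl

theorem exists_infinite_tailFilter_le (hρ : Monotone ρ) {l : Filter Λ} (hl : l.IsCountablyGenerated)
    (h : ∀ A : ℕ → Set Λ, (∀ n, A n ∈ l) →
      ∃ D : Set ℕ, D.Infinite ∧ ∀ n, ∃ K : Set ℕ, K.Finite ∧ ρ (D \ K) ⊆ A n) :
    ∃ D : Set ℕ, D.Infinite ∧ tailFilter ρ D ≤ l := by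
  obtain ⟨A, hA⟩ := exists_antitone_basis l
  obtain ⟨D, hD, hDA⟩ := h A hA.mem
  exact ⟨D, hD, hA.toHasBasis.ge_iff.2 fun n _ => (hasBasis_tailFilter hρ D).mem_iff.2 (hDA n)⟩

end TailFilter

section Fusion

variable {v : Filter ℕ}

theorem eventually_gt_of_le_cofinite (hv : v ≤ cofinite) (n : ℕ) : ∀ᶠ x in v, n < x :=
  (hv.trans Nat.cofinite_eq_atTop.le) (eventually_gt_atTop n)

theorem exists_strictMono_forall_image [v.NeBot] (hv : v ≤ cofinite)
    {R : ℕ → Finset ℕ → ℕ → Prop} (hR : ∀ n α, ∀ᶠ x in v, R n α x) :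
    ∃ d : ℕ → ℕ, StrictMono d ∧ ∀ n, ∀ γ ⊆ Finset.range n, R n (γ.image d) (d n) := by
  have hnext (n : ℕ) (s : Finset ℕ) : ∃ x, (∀ y ∈ s, y < x) ∧ ∀ α ∈ s.powerset, R n α x :=
    (((eventually_all_finset s).2 fun y _ => eventually_gt_of_le_cofinite hv y).and
      ((eventually_all_finset s.powerset).2 fun α _ => hR n α)).exists
  choose g hg_lt hgR using hnext
  let s : ℕ → Finset ℕ := Nat.rec ∅ fun n t => insert (g n t) t
  let d (n : ℕ) : ℕ := g n (s n)
  have hs (n : ℕ) : s n = (Finset.range n).image d := by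
    induction n with
    | zero => rfl
    | succ n ih =>
      rw [Finset.range_add_one, Finset.image_insert, ← ih]
  refine ⟨d, fun m n hmn => ?_, fun n γ hγ => ?_⟩
  · refine hg_lt n (s n) (d m) ?_
    rw [hs]
    exact Finset.mem_image_of_mem d (Finset.mem_range.2 hmn)
  · refine hgR n (s n) _ ?_
    rw [hs, Finset.mem_powerset]
    exact Finset.image_subset_image hγ

theorem exists_infinite_forall_finset_mem [v.NeBot] (hv : v ≤ cofinite)
    {𝒢 : ℕ → Set (Finset ℕ)} (hempty : ∀ k, ∅ ∈ 𝒢 k)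
    (hinsert : ∀ k, ∀ α ∈ 𝒢 k, ∀ᶠ x in v, insert x α ∈ 𝒢 k) :
    ∃ D : Set ℕ, D.Infinite ∧
      ∀ k, ∃ K : Set ℕ, K.Finite ∧ ∀ α : Finset ℕ, (α : Set ℕ) ⊆ D \ K → α ∈ 𝒢 k := by
  obtain ⟨d, hd, hd𝒢⟩ := exists_strictMono_forall_image hv
    (R := fun n α x => ∀ k ∈ Finset.range (n + 1), α ∈ 𝒢 k → insert x α ∈ 𝒢 k) fun n α =>
      (eventually_all_finset _).2 fun k _ => eventually_imp_distrib_left.2 (hinsert k α)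
  have himage (k : ℕ) (β : Finset ℕ) : (β : Set ℕ) ⊆ Ici k → β.image d ∈ 𝒢 k := by
    induction β using Finset.induction_on_max with
    | empty => exact fun _ => hempty k
    | insert n β hβ ih =>
      intro hk
      rw [Finset.coe_insert, insert_subset_iff] at hk
      rw [Finset.image_insert]
      exact hd𝒢 n β (fun i hi => Finset.mem_range.2 (hβ i hi)) k
        (Finset.mem_range_succ_iff.2 hk.1) (ih hk.2)
  refine ⟨range d, infinite_range_of_injective hd.injective, fun k =>
    ⟨d '' Iio k, (finite_Iio k).image d, fun α hα => ?_⟩⟩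
  have hα' : (α : Set ℕ) ⊆ d '' Ici k := by
    rintro x hx
    obtain ⟨⟨i, rfl⟩, hi⟩ := hα hx
    exact ⟨i, mem_Ici.2 (not_lt.1 fun h => hi ⟨i, h, rfl⟩), rfl⟩
  obtain ⟨β, hβ, rfl⟩ := Finset.subset_set_image_iff.1 hα'
  exact himage k β hβ

theorem exists_ultrafilter_le_cofinite_inf_principal {E : Set ℕ} (hE : E.Infinite) :
    ∃ v : Ultrafilter ℕ, (v : Filter ℕ) ≤ cofinite ∧ ∀ K : Set ℕ, K.Finite → E \ K ∈ v := by
  have := hE.cofinite_inf_principal_neBot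
  have hv := Ultrafilter.of_le (cofinite ⊓ 𝓟 E)
  refine ⟨Ultrafilter.of (cofinite ⊓ 𝓟 E), hv.trans inf_le_left, fun K hK => ?_⟩
  exact inter_mem (hv.trans inf_le_right (mem_principal_self E))
    (hv.trans inf_le_left hK.compl_mem_cofinite)

end Fusion

section Pairs

/-- The pair `{a, b}`, as an element of `[ω]²`; the junk value `{0, 1}` if `a = b`. -/
def mkNatPair (a b : ℕ) : NatPair :=
  if h : a = b then ⟨{0, 1}, Finset.card_pair zero_ne_one⟩ else ⟨{a, b}, Finset.card_pair h⟩

theorem coe_mkNatPair {a b : ℕ} (h : a < b) : (mkNatPair a b : Finset ℕ) = {a, b} := by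
  rw [mkNatPair, dif_neg h.ne]

theorem exists_mkNatPair_eq (s : NatPair) : ∃ a b, a < b ∧ mkNatPair a b = s := by
  obtain ⟨a, b, hab, hs⟩ := Finset.card_eq_two.1 s.2
  rcases lt_or_gt_of_ne hab with h | h
  · exact ⟨a, b, h, Subtype.ext (by rw [coe_mkNatPair h, hs])⟩
  · exact ⟨b, a, h, Subtype.ext (by rw [coe_mkNatPair h, hs, Finset.pair_comm])⟩

theorem mkNatPair_mem_pairsOf {a b : ℕ} (h : a < b) {D : Set ℕ} :
    mkNatPair a b ∈ pairsOf D ↔ a ∈ D ∧ b ∈ D := by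
  simp only [pairsOf, mem_ofPred_eq, coe_mkNatPair h, Finset.coe_pair, pair_subset_iff]

theorem pairsOf_mono : Monotone pairsOf := fun _ _ h _ hs => Set.Subset.trans hs h

/-- The product ultrafilter `v ⊗ v`, carried over to `[ω]²`. -/
def pairUltrafilter (v : Ultrafilter ℕ) : Ultrafilter NatPair :=
  v.bind fun a => v.map (mkNatPair a)

theorem eventually_pairUltrafilter {v : Ultrafilter ℕ} {P : NatPair → Prop} :
    (∀ᶠ s in pairUltrafilter v, P s) ↔ ∀ᶠ a in v, ∀ᶠ b in v, P (mkNatPair a b) :=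
  Iff.rfl

theorem pairsOf_mem_pairUltrafilter {v : Ultrafilter ℕ} (hv : (v : Filter ℕ) ≤ cofinite)
    {E : Set ℕ} (hE : E ∈ v) : pairsOf E ∈ pairUltrafilter v := by
  refine eventually_pairUltrafilter.2 ?_
  filter_upwards [hE] with a ha
  filter_upwards [hE, eventually_gt_of_le_cofinite hv a] with b hb hab
  exact (mkNatPair_mem_pairsOf hab).2 ⟨ha, hb⟩

theorem exists_infinite_pairsOf_subset {v : Ultrafilter ℕ} (hv : (v : Filter ℕ) ≤ cofinite)
    {A : ℕ → Set NatPair} (hA : ∀ n, A n ∈ pairUltrafilter v) :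
    ∃ D : Set ℕ, D.Infinite ∧ ∀ n, ∃ K : Set ℕ, K.Finite ∧ pairsOf (D \ K) ⊆ A n := by
  obtain ⟨D, hD, hDA⟩ := exists_infinite_forall_finset_mem hv
    (𝒢 := fun k => {α | ∀ a ∈ α, (∀ᶠ b in v, mkNatPair a b ∈ A k) ∧
      ∀ b ∈ α, a < b → mkNatPair a b ∈ A k}) (fun k => by simp) fun k α hα => by
    filter_upwards [hA k, (eventually_all_finset α).2 fun a ha => (hα a ha).1,
      (eventually_all_finset α).2 fun a _ => eventually_gt_of_le_cofinite hv a] with x hx hαx hlt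
    rw [Finset.forall_mem_insert]
    refine ⟨⟨hx, fun b hb hxb => ?_⟩, fun a ha => ⟨(hα a ha).1, fun b hb hab => ?_⟩⟩
    · rcases Finset.mem_insert.1 hb with rfl | hb
      exacts [absurd hxb (lt_irrefl _), absurd hxb (hlt b hb).not_gt]
    · rcases Finset.mem_insert.1 hb with rfl | hb
      exacts [hαx a ha, (hα a ha).2 b hb hab]
  refine ⟨D, hD, fun n => (hDA n).imp fun K ⟨hK, hKA⟩ => ⟨hK, fun s hs => ?_⟩⟩
  obtain ⟨a, b, hab, rfl⟩ := exists_mkNatPair_eq s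
  have hmem := hKA {a, b} (by rwa [← coe_mkNatPair hab])
  exact (hmem a (by simp)).2 b (by simp) hab

theorem infinite_pairsOf {D : Set ℕ} (hD : D.Infinite) : (pairsOf D).Infinite := by
  obtain ⟨a, ha⟩ := hD.nonempty
  refine ((hD.sdiff (finite_Iic a)).image (f := mkNatPair a) fun b hb c hc h => ?_).mono ?_
  · have hb' : a < b := not_le.1 hb.2
    have hc' : a < c := not_le.1 hc.2
    have hbc : b ∈ (mkNatPair a c : Finset ℕ) := by simp [← h, coe_mkNatPair hb']
    simpa [coe_mkNatPair hc', hb'.ne'] using hbc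
  · rintro _ ⟨b, hb, rfl⟩
    exact (mkNatPair_mem_pairsOf (not_le.1 hb.2)).2 ⟨ha, hb.1⟩

theorem pairUltrafilter_le_tailFilter {v : Ultrafilter ℕ} (hv : (v : Filter ℕ) ≤ cofinite)
    {E : Set ℕ} (hE : ∀ K : Set ℕ, K.Finite → E \ K ∈ v) :
    ↑(pairUltrafilter v) ≤ tailFilter pairsOf E :=
  (hasBasis_tailFilter pairsOf_mono E).ge_iff.2 fun K hK =>
    pairsOf_mem_pairUltrafilter hv (hE K hK)

theorem isDiagonalizable_pairsOf : IsDiagonalizable pairsOf where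
  monotone := pairsOf_mono
  infinite := infinite_pairsOf
  exists_ultrafilter hE := by
    obtain ⟨v, hv, hvE⟩ := exists_ultrafilter_le_cofinite_inf_principal hE
    exact ⟨pairUltrafilter v, pairUltrafilter_le_tailFilter hv hvE, fun l hl hvl =>
      exists_infinite_tailFilter_le pairsOf_mono hl fun A hA =>
        exists_infinite_pairsOf_subset hv fun n => hvl (hA n)⟩

end Pairs

section Differences

/-- `b - a` for a pair `{a, b}` with `a < b`. -/
def pairDifference (s : NatPair) : ℕ := s.1.sup id - (∑ i ∈ s.1, i - s.1.sup id)

theorem pairDifference_mkNatPair {a b : ℕ} (h : a < b) :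
    pairDifference (mkNatPair a b) = b - a := by
  simp [pairDifference, coe_mkNatPair h, Finset.sum_pair h.ne, h.le]

theorem pairDifference_image_pairsOf (E : Set ℕ) :
    pairDifference '' pairsOf E = posDifferences E := by
  ext x
  constructor
  · rintro ⟨s, hs, rfl⟩
    obtain ⟨a, b, hab, rfl⟩ := exists_mkNatPair_eq s
    obtain ⟨ha, hb⟩ := (mkNatPair_mem_pairsOf hab).1 hs
    exact ⟨b, hb, a, ha, hab, (pairDifference_mkNatPair hab).symm⟩
  · rintro ⟨a, ha, b, hb, hba, rfl⟩
    exact ⟨mkNatPair b a, (mkNatPair_mem_pairsOf hba).2 ⟨hb, ha⟩, pairDifference_mkNatPair hba⟩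

theorem posDifferences_eq_image : posDifferences = fun E => pairDifference '' pairsOf E :=
  funext fun E => (pairDifference_image_pairsOf E).symm

theorem infinite_posDifferences {D : Set ℕ} (hD : D.Infinite) : (posDifferences D).Infinite := by
  obtain ⟨b, hb⟩ := hD.nonempty
  refine infinite_of_forall_exists_gt fun n => ?_
  obtain ⟨a, ha, hlt⟩ := hD.exists_gt (b + n)
  exact ⟨a - b, ⟨a, ha, b, hb, by omega, rfl⟩, by omega⟩

theorem isDiagonalizable_posDifferences : IsDiagonalizable posDifferences := by
  rw [posDifferences_eq_image]
  exact isDiagonalizable_pairsOf.image pairDifference fun hD => by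
    rw [pairDifference_image_pairsOf]
    exact infinite_posDifferences hD

end Differences

section FiniteSums

theorem finiteSums_mono : Monotone finiteSums :=
  fun _ _ h _ ⟨α, hα, hαD, hx⟩ => ⟨α, hα, hαD.trans h, hx⟩

theorem subset_finiteSums (D : Set ℕ) : D ⊆ finiteSums D := fun n hn =>
  ⟨{n}, Finset.singleton_nonempty n, by simpa using hn, by simp⟩

theorem exists_finite_add_mem_finiteSums {D : Set ℕ} {m : ℕ} (hm : m ∈ finiteSums D) :
    ∃ K : Set ℕ, K.Finite ∧ ∀ n ∈ finiteSums (D \ K), m + n ∈ finiteSums D := by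
  obtain ⟨α, hα, hαD, rfl⟩ := hm
  refine ⟨α, α.finite_toSet, ?_⟩
  rintro _ ⟨β, -, hβD, rfl⟩
  have hdisj : Disjoint α β :=
    Finset.disjoint_left.2 fun x hxα hxβ => (hβD hxβ).2 hxα
  refine ⟨α ∪ β, hα.mono Finset.subset_union_left, ?_, Finset.sum_union hdisj⟩
  rw [Finset.coe_union]
  exact union_subset hαD (hβD.trans sdiff_subset)

theorem isClosed_setOf_ultrafilter_le {Λ : Type*} (l : Filter Λ) :
    IsClosed {U : Ultrafilter Λ | ↑U ≤ l} := by
  have : {U : Ultrafilter Λ | ↑U ≤ l} = ⋂ s ∈ l, {U | s ∈ U} := by ext; simp [Filter.le_def]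
  rw [this]
  exact isClosed_biInter fun s _ => ultrafilter_isClosed_basic s

theorem exists_idempotent_ultrafilter_le_tailFilter {E : Set ℕ} (hE : E.Infinite) :
    ∃ U : Ultrafilter ℕ, ↑U ≤ tailFilter finiteSums E ∧
      ∀ P : ℕ → Prop, (∀ᶠ m in U, P m) ↔ ∀ᶠ m in U, ∀ᶠ n in U, P (m + n) := by
  let _ := Ultrafilter.addSemigroup (M := ℕ)
  have hbasis := hasBasis_tailFilter finiteSums_mono E
  have hne : {U : Ultrafilter ℕ | ↑U ≤ tailFilter finiteSums E}.Nonempty := by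
    obtain ⟨v, -, hvE⟩ := exists_ultrafilter_le_cofinite_inf_principal hE
    exact ⟨v, hbasis.ge_iff.2 fun K hK => mem_of_superset (hvE K hK) (subset_finiteSums _)⟩
  obtain ⟨U, hU, hUU⟩ := exists_idempotent_in_compact_add_subsemigroup
    Ultrafilter.continuous_add_left _ hne (isClosed_setOf_ultrafilter_le _).isCompact
    fun U hU V hV => hbasis.ge_iff.2 fun K hK => by
      change ∀ᶠ m in U, ∀ᶠ n in V, m + n ∈ finiteSums (E \ K)
      filter_upwards [hU (hbasis.mem_of_mem hK)] with m hm
      obtain ⟨L, hL, hadd⟩ := exists_finite_add_mem_finiteSums hm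
      rw [sdiff_sdiff] at hadd
      exact mem_of_superset (hV (hbasis.mem_of_mem (hK.union hL))) hadd
  refine ⟨U, hU, fun P => ?_⟩
  conv_lhs => rw [← hUU]
  exact Iff.rfl

theorem tailFilter_finiteSums_le_cofinite (E : Set ℕ) : tailFilter finiteSums E ≤ cofinite := by
  refine tailFilter_le_cofinite finiteSums_mono fun x => ⟨Iic x, finite_Iic x, ?_⟩
  rintro ⟨α, ⟨a, ha⟩, hαE, hsum⟩
  exact (hαE ha).2 ((Finset.single_le_sum (f := id) (fun _ _ => Nat.zero_le _) ha).trans_eq hsum)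

theorem eventually_sum_insert {v : Filter ℕ} (hv : v ≤ cofinite) (α : Finset ℕ) :
    ∀ᶠ x in v, ∑ i ∈ insert x α, i = ∑ i ∈ α, i + x := by
  filter_upwards [hv α.finite_toSet.compl_mem_cofinite] with x hx
  rw [Finset.sum_insert hx, add_comm]

theorem exists_infinite_finiteSums_subset {U : Ultrafilter ℕ} (hU : (U : Filter ℕ) ≤ cofinite)
    (hUU : ∀ P : ℕ → Prop, (∀ᶠ m in U, P m) ↔ ∀ᶠ m in U, ∀ᶠ n in U, P (m + n))
    {A : ℕ → Set ℕ} (hA : ∀ n, A n ∈ U) :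
    ∃ D : Set ℕ, D.Infinite ∧ ∀ n, ∃ K : Set ℕ, K.Finite ∧ finiteSums (D \ K) ⊆ A n := by
  obtain ⟨D, hD, hDA⟩ := exists_infinite_forall_finset_mem hU
    (𝒢 := fun k => {α | (α.Nonempty → ∑ i ∈ α, i ∈ A k) ∧ ∀ᶠ e in U, ∑ i ∈ α, i + e ∈ A k})
    (fun k => ⟨by simp, by simpa using hA k⟩) fun k α ⟨_, hα⟩ => by
    filter_upwards [hα, (hUU _).1 hα, eventually_sum_insert hU α] with x hx hxU hsum
    rw [hsum]
    exact ⟨fun _ => hx, by simpa only [add_assoc] using hxU⟩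
  refine ⟨D, hD, fun n => (hDA n).imp fun K ⟨hK, hKA⟩ => ⟨hK, ?_⟩⟩
  rintro _ ⟨α, hα, hαD, rfl⟩
  exact (hKA α hαD).1 hα

theorem isDiagonalizable_finiteSums : IsDiagonalizable finiteSums where
  monotone := finiteSums_mono
  infinite hD := hD.mono (subset_finiteSums _)
  exists_ultrafilter {E} hE := by
    obtain ⟨U, hUE, hUU⟩ := exists_idempotent_ultrafilter_le_tailFilter hE
    have hU := hUE.trans (tailFilter_finiteSums_le_cofinite E)
    exact ⟨U, hUE, fun l hl hUl => exists_infinite_tailFilter_le finiteSums_mono hl fun A hA =>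
      exists_infinite_finiteSums_subset hU hUU fun n => hUl (hA n)⟩

end FiniteSums

section CountablyGeneratedFilters

theorem isCountablyGenerated_cofinite {Λ : Type*} [Countable Λ] :
    (cofinite : Filter Λ).IsCountablyGenerated :=
  HasCountableBasis.isCountablyGenerated ⟨hasBasis_cofinite, Countable.ofPred_finite⟩

theorem exists_infinite_subset_cofinite_inf_principal_le {Λ : Type*} {F : Filter Λ} [F.NeBot]
    [F.IsCountablyGenerated] (hF : F ≤ cofinite) {A : Set Λ} (hA : A ∈ F) :
    ∃ B ⊆ A, B.Infinite ∧ cofinite ⊓ 𝓟 B ≤ F := by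
  obtain ⟨x, hx⟩ := exists_seq_tendsto F
  refine ⟨A ∩ range x, inter_subset_left, fun hfin => ?_, ?_⟩
  · obtain ⟨n, hnA, hn⟩ := (hx.eventually_mem (inter_mem hA (hF hfin.compl_mem_cofinite))).exists
    exact hn ⟨hnA, mem_range_self n⟩
  · calc cofinite ⊓ 𝓟 (A ∩ range x)
      _ ≤ cofinite ⊓ 𝓟 (range x) := inf_le_inf_left _ (principal_mono.2 inter_subset_right)
      _ = map x (comap x cofinite) := (map_comap _ _).symm
      _ ≤ map x atTop := map_mono ((comap_cofinite_le x).trans Nat.cofinite_eq_atTop.le)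
      _ ≤ F := hx

theorem exists_isCountablyGenerated_ge_disjoint {Λ : Type*} {l : Filter Λ} {C : Set (Filter Λ)}
    (hC : C.Countable) (hlC : ∀ G ∈ C, Disjoint l G) :
    ∃ F : Filter Λ, F.IsCountablyGenerated ∧ l ≤ F ∧ ∀ G ∈ C, Disjoint F G := by
  have := hC.to_subtype
  have hsep (G : C) : ∃ s ∈ l, sᶜ ∈ G.1 := by
    obtain ⟨s, hs, t, ht, hst⟩ := Filter.disjoint_iff.1 (hlC G G.2)
    exact ⟨s, hs, mem_of_superset ht hst.subset_compl_left⟩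
  choose s hsl hsG using hsep
  refine ⟨⨅ G : C, 𝓟 (s G), inferInstance, le_iInf fun G => le_principal_iff.2 (hsl G),
    fun G hG => ?_⟩
  exact Filter.disjoint_iff.2 ⟨s ⟨G, hG⟩, mem_iInf_of_mem ⟨G, hG⟩ (mem_principal_self _), _,
    hsG ⟨G, hG⟩, disjoint_compl_right⟩

theorem disjoint_cofinite_inf_principal_iff {Λ : Type*} {F : Filter Λ} {B : Set Λ}
    (hF : F ≤ cofinite) : Disjoint F (cofinite ⊓ 𝓟 B) ↔ Bᶜ ∈ F := by
  rw [disjoint_iff, ← inf_assoc, inf_eq_left.2 hF, ← disjoint_iff, disjoint_principal_right]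

theorem compl_mem_cofinite_inf_principal {Λ : Type*} {A B : Set Λ} :
    Bᶜ ∈ cofinite ⊓ 𝓟 A ↔ (A ∩ B).Finite := by
  rw [mem_inf_principal, mem_cofinite]
  congr! 1
  ext x
  simp

end CountablyGeneratedFilters

section TransfiniteChoice

universe u

theorem exists_wellOrder_countable_Iio {T : Type u} (hT : #T ≤ ℵ₁) :
    ∃ (_ : LinearOrder T) (_ : WellFoundedLT T), ∀ t : T, (Iio t).Countable := by
  obtain ⟨e⟩ : Nonempty (T ↪ (ℵ₁ : Cardinal.{u}).ord.ToType) := by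
    rwa [← Cardinal.le_def, mk_toType, card_ord]
  let _ : LinearOrder T := LinearOrder.lift' e e.injective
  have he : StrictMono e := fun _ _ h => h
  refine ⟨inferInstance, he.wellFoundedLT, fun t => ?_⟩
  have hcount : (Iio (e t)).Countable := by
    rw [← le_aleph0_iff_set_countable, ← Order.lt_succ_iff, succ_aleph0]
    simpa using mk_Iio_lt (e t) (by simp)
  exact hcount.preimage e.injective

theorem exists_transfinite_choice {T : Type u} {X : Type*} (hT : #T ≤ ℵ₁) {S : Set X}
    {P : T → Set X → X → Prop} (h : ∀ t, ∀ C ⊆ S, C.Countable → ∃ x ∈ S, P t C x) :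
    ∃ (_ : LinearOrder T) (F : T → X), ∀ t, F t ∈ S ∧ P t (F '' Iio t) (F t) := by
  obtain ⟨hlin, _, hcount⟩ := exists_wellOrder_countable_Iio hT
  choose x hxS hxP using h
  let F : T → S := WellFoundedLT.fix fun t ih =>
    have := (hcount t).to_subtype
    let C : Set X := range fun s : Iio t => (ih s s.2 : X)
    have hC : C ⊆ S := range_subset_iff.2 fun s => (ih s s.2).2
    ⟨x t C hC (countable_range _), hxS t C hC _⟩
  refine ⟨hlin, fun t => F t, fun t => ⟨(F t).2, ?_⟩⟩
  dsimp only
  rw [image_eq_range, show F t = _ from WellFoundedLT.fix_eq _ t]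
  exact hxP t _ _ _

end TransfiniteChoice

section Ideals

variable {Λ Γ : Type*} {I : Set (Set Λ)} {J : Set (Set Γ)} {ρ : Set ℕ → Set Λ}

/-- The filter of the complements of the members of an ideal. -/
def IsIdealOn.dualFilter (hI : IsIdealOn I) : Filter Λ :=
  comk (· ∈ I) (hI.finite_mem ∅ finite_empty) (fun B hB A hAB => hI.subset_mem A B hAB hB)
    fun A hA B hB => hI.union_mem A B hA hB

theorem IsIdealOn.compl_mem_dualFilter (hI : IsIdealOn I) {A : Set Λ} (hA : A ∈ I) :
    Aᶜ ∈ hI.dualFilter := by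
  rwa [IsIdealOn.dualFilter, compl_mem_comk]

theorem IsIdealOn.dualFilter_le_cofinite (hI : IsIdealOn I) : hI.dualFilter ≤ cofinite :=
  le_cofinite_iff_compl_singleton_mem.2 fun x =>
    hI.compl_mem_dualFilter (hI.finite_mem {x} (finite_singleton x))

theorem IsIdealOn.dualFilter_inf_principal_neBot (hI : IsIdealOn I) {A : Set Λ} (hA : A ∉ I) :
    (hI.dualFilter ⊓ 𝓟 A).NeBot := by
  refine inf_principal_neBot_iff.2 fun U hU => nonempty_iff_ne_empty.2 fun hUA => hA ?_
  exact hI.subset_mem A Uᶜ (disjoint_iff_inter_eq_empty.2 hUA).subset_compl_left hU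

theorem exists_infinite_image_mem_of_not_katetovLE (hJ : IsIdealOn J)
    (hK : ¬ KatetovLE J (idealOf ρ)) (f : Λ → Γ) :
    ∃ D : Set ℕ, D.Infinite ∧ f '' ρ D ∈ J := by
  simp only [KatetovLE, idealOf, mem_ofPred_eq] at hK
  push Not at hK
  obtain ⟨A, ⟨D, hD, hDA⟩, hA⟩ := hK f
  exact ⟨D, hD, hJ.subset_mem _ _ (image_mono hDA) hA⟩

theorem IsDiagonalizable.exists_infinite_subset_mem [Countable Λ] (hρ : IsDiagonalizable ρ)
    (hJ : IsIdealOn J) (hK : ¬ KatetovLE J (idealOf ρ)) {B : Set Γ} (hB : B.Infinite) :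
    ∃ B' ⊆ B, B'.Infinite ∧ B' ∈ J := by
  obtain ⟨g, hg⟩ := exists_injective_nat Λ
  have hf : Function.Injective fun x => (hB.natEmbedding B (g x) : Γ) :=
    Subtype.val_injective.comp ((hB.natEmbedding B).injective.comp hg)
  obtain ⟨D, hD, hDJ⟩ := exists_infinite_image_mem_of_not_katetovLE hJ hK _
  exact ⟨_, image_subset_iff.2 fun x _ => Subtype.coe_prop _, (hρ.infinite hD).image hf.injOn, hDJ⟩

end Ideals

section Construction

variable {Λ : Type*} {ρ : Set ℕ → Set Λ} {I : Set (Set ℕ)}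

/-- The filters on `ω` that may occur at a stage of the transfinite construction. A small filter
contains a member of `I`, so countably many of them cannot exhaust a set outside `I`. -/
def smallFilters (I : Set (Set ℕ)) : Set (Filter ℕ) :=
  {F | F ≤ cofinite ∧ F.IsCountablyGenerated ∧ ∃ B ∈ F, B ∈ I}

theorem IsIdealOn.bot_mem_smallFilters (hI : IsIdealOn I) : ⊥ ∈ smallFilters I :=
  ⟨bot_le, inferInstance, ∅, mem_bot, hI.finite_mem ∅ finite_empty⟩

theorem cofinite_inf_principal_mem_smallFilters {B : Set ℕ} (hB : B ∈ I) :
    cofinite ⊓ 𝓟 B ∈ smallFilters I :=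
  have := isCountablyGenerated_cofinite (Λ := ℕ)
  ⟨inf_le_left, inferInstance, B, mem_inf_of_right (mem_principal_self B), hB⟩

theorem exists_smallFilter_disjoint_hasTailLimitIn (hρ : IsDiagonalizable ρ) (hI : IsIdealOn I)
    (hK : ¬ KatetovLE I (idealOf ρ)) {C : Set (Filter ℕ)} (hC : C.Countable)
    (hCI : C ⊆ smallFilters I) (f : Λ → ℕ) :
    ∃ F ∈ smallFilters I, (∀ G ∈ C, Disjoint F G) ∧
      HasTailLimitIn ρ f (range pure ∪ insert F C) := by
  obtain ⟨D, hD, hDI⟩ := exists_infinite_image_mem_of_not_katetovLE hI hK f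
  obtain ⟨p, hpD, hp⟩ := hρ.exists_ultrafilter_hasTailLimitIn hD
  rcases (p.map f).le_cofinite_or_eq_pure with hcof | ⟨n, hn⟩
  · by_cases hpC : ∃ G ∈ C, Tendsto f p G
    · obtain ⟨G, hG, hpG⟩ := hpC
      exact ⟨⊥, hI.bot_mem_smallFilters, fun _ _ => disjoint_bot_left,
        hp G (Or.inr (mem_insert_of_mem _ hG)) (hCI hG).2.1 hpG⟩
    · push Not at hpC
      obtain ⟨F, hFcg, hpF, hFC⟩ := exists_isCountablyGenerated_ge_disjoint (l := p.map f) hC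
        fun G hG => Ultrafilter.disjoint_iff_not_le.2 (hpC G hG)
      obtain ⟨hle, hcg, B, hB, hBI⟩ := cofinite_inf_principal_mem_smallFilters hDI
      have hp_image : Tendsto f p (cofinite ⊓ 𝓟 (f '' ρ D)) :=
        tendsto_inf.2 ⟨hcof, tendsto_principal.2 (mem_of_superset hpD fun x => mem_image_of_mem f)⟩
      exact ⟨F ⊓ (cofinite ⊓ 𝓟 (f '' ρ D)),
        ⟨inf_le_right.trans hle, inferInstance, B, mem_inf_of_right hB, hBI⟩,
        fun G hG => (hFC G hG).mono_left inf_le_left,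
        hp _ (Or.inr (mem_insert _ _)) inferInstance (tendsto_inf.2 ⟨hpF, hp_image⟩)⟩
  · exact ⟨⊥, hI.bot_mem_smallFilters, fun _ _ => disjoint_bot_left,
      hp (pure n) (Or.inl (mem_range_self n)) inferInstance (congrArg Ultrafilter.toFilter hn).le⟩

theorem exists_infinite_subset_mem_disjoint [Countable Λ] (hρ : IsDiagonalizable ρ)
    (hI : IsIdealOn I) (hK : ¬ KatetovLE I (idealOf ρ)) {C : Set (Filter ℕ)} (hC : C.Countable)
    (hCI : C ⊆ smallFilters I) {A : Set ℕ} (hA : A ∉ I) :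
    ∃ B ⊆ A, B.Infinite ∧ B ∈ I ∧ ∀ G ∈ C, Disjoint (cofinite ⊓ 𝓟 B) G := by
  obtain ⟨F, _, hIF, hFC⟩ := exists_isCountablyGenerated_ge_disjoint (l := hI.dualFilter) hC
    fun G hG => by
      obtain ⟨-, -, B, hBG, hB⟩ := hCI hG
      exact Filter.disjoint_iff.2 ⟨Bᶜ, hI.compl_mem_dualFilter hB, B, hBG, disjoint_compl_left⟩
  have := isCountablyGenerated_cofinite (Λ := ℕ)
  have : (F ⊓ (cofinite ⊓ 𝓟 A)).NeBot := (hI.dualFilter_inf_principal_neBot hA).mono <|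
    le_inf (inf_le_left.trans hIF) (inf_le_inf_right _ hI.dualFilter_le_cofinite)
  obtain ⟨B, hBA, hB, hBF⟩ := exists_infinite_subset_cofinite_inf_principal_le
    (F := F ⊓ (cofinite ⊓ 𝓟 A)) (inf_le_right.trans inf_le_left)
    (mem_inf_of_right (mem_inf_of_right (mem_principal_self A)))
  obtain ⟨B', hB'B, hB', hB'I⟩ := hρ.exists_infinite_subset_mem hI hK hB
  have hB'F : cofinite ⊓ 𝓟 B' ≤ F :=
    (inf_le_inf_left _ (principal_mono.2 hB'B)).trans (hBF.trans inf_le_left)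
  exact ⟨B', hB'B.trans hBA, hB', hB'I, fun G hG => (hFC G hG).mono_left hB'F⟩

theorem mk_functions_sum_subtype_le_continuum [Countable Λ] (I : Set (Set ℕ)) :
    #((Λ → ℕ) ⊕ {A : Set ℕ // A ∉ I}) ≤ 𝔠 := by
  have hfun : #(Λ → ℕ) ≤ 𝔠 := by
    rw [mk_arrow, ← aleph0_power_aleph0, mk_nat, lift_aleph0]
    exact power_le_power_left aleph0_ne_zero (lift_le_aleph0.2 mk_le_aleph0)
  have hsub : #{A : Set ℕ // A ∉ I} ≤ 𝔠 :=
    (mk_subtype_le _).trans (by rw [mk_set_nat])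
  rw [mk_sum, ← continuum_add_self]
  exact add_le_add (lift_le_continuum.2 hfun) (lift_le_continuum.2 hsub)

theorem exists_almostDisjoint_forall_hasTailLimitIn (hCH : (ℵ₁ : Cardinal.{0}) = 𝔠) [Countable Λ]
    (hρ : IsDiagonalizable ρ) (hI : IsIdealOn I) (hK : ¬ KatetovLE I (idealOf ρ)) :
    ∃ B : {A : Set ℕ // A ∉ I} → Set ℕ,
      (∀ A, B A ⊆ A ∧ (B A).Infinite ∧ B A ∈ I) ∧ (∀ A A', A ≠ A' → (B A ∩ B A').Finite) ∧
      ∀ f : Λ → ℕ, HasTailLimitIn ρ f (range pure ∪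
        insert (cofinite ⊓ ⨅ A, 𝓟 (B A)ᶜ) (range fun A => cofinite ⊓ 𝓟 (B A))) := by
  have hT : #((Λ → ℕ) ⊕ {A : Set ℕ // A ∉ I}) ≤ ℵ₁ := by
    have := congrArg lift hCH
    rw [lift_aleph, Ordinal.lift_one, lift_continuum] at this
    exact (mk_functions_sum_subtype_le_continuum I).trans_eq this.symm
  obtain ⟨_, F, hF⟩ := exists_transfinite_choice hT (S := smallFilters I)
    (P := fun t C F => (∀ G ∈ C, Disjoint F G) ∧ Sum.elim
      (fun f => HasTailLimitIn ρ f (range pure ∪ insert F C))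
      (fun A => ∃ B ⊆ A.1, B.Infinite ∧ B ∈ I ∧ F = cofinite ⊓ 𝓟 B) t) (by
    rintro (f | A) C hCI hC
    · exact exists_smallFilter_disjoint_hasTailLimitIn hρ hI hK hC hCI f
    · obtain ⟨B, hBA, hB, hBI, hBC⟩ := exists_infinite_subset_mem_disjoint hρ hI hK hC hCI A.2
      exact ⟨_, cofinite_inf_principal_mem_smallFilters hBI, hBC, B, hBA, hB, hBI, rfl⟩)
  have hdisj : Pairwise fun s t => Disjoint (F s) (F t) := fun s t hst => by
    rcases lt_or_gt_of_ne hst with h | h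
    · exact ((hF t).2.1 _ (mem_image_of_mem F h)).symm
    · exact (hF s).2.1 _ (mem_image_of_mem F h)
  choose B hBA hB hBI hFB using fun A => (hF (Sum.inr A)).2.2
  have hFB_disj {t : (Λ → ℕ) ⊕ {A : Set ℕ // A ∉ I}} {A} (h : t ≠ Sum.inr A) : (B A)ᶜ ∈ F t := by
    rw [← disjoint_cofinite_inf_principal_iff (hF t).1.1, ← hFB]
    exact hdisj h
  refine ⟨B, fun A => ⟨hBA A, hB A, hBI A⟩, fun A A' h => ?_, fun f => ?_⟩
  · rw [← compl_mem_cofinite_inf_principal, ← hFB]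
    exact hFB_disj (Sum.inr_injective.ne h)
  · refine (hF (Sum.inl f)).2.2.comp (g := id) ?_
    rw [← image_insert_eq]
    rintro _ (hG | ⟨g | A, -, rfl⟩)
    · exact ⟨_, Or.inl hG, tendsto_id⟩
    · refine ⟨_, Or.inr (mem_insert _ _), le_inf (hF _).1.1 (le_iInf fun A => ?_)⟩
      exact le_principal_iff.2 (hFB_disj Sum.inl_ne_inr)
    · exact ⟨_, Or.inr (mem_insert_of_mem _ (mem_range_self A)), (hFB A).le⟩

end Construction

section CofiniteFilters

variable {Λ X : Type*}

theorem disjoint_pure_of_le_cofinite {F : Filter X} (hF : F ≤ cofinite) (x : X) :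
    Disjoint F (pure x) := by
  rw [← principal_singleton, disjoint_principal_right]
  exact hF (finite_singleton x).compl_mem_cofinite

theorem isCountablyGenerated_comap_cofinite [Countable Λ] (f : Λ → X) :
    (comap f cofinite).IsCountablyGenerated := by
  have := (countable_range f).to_subtype
  have := isCountablyGenerated_cofinite (Λ := range f)
  have : comap f cofinite = comap (rangeFactorization f) cofinite := by
    rw [← Subtype.val_injective.comap_cofinite_eq, comap_comap]
    rfl
  rw [this]
  infer_instance

theorem tendsto_subtype_cofinite_iff {A : Set Λ} {f : Λ → X} {l : Filter X} :
    Tendsto (fun a : A => f a) cofinite l ↔ Tendsto f (cofinite ⊓ 𝓟 A) l := by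
  rw [← Subtype.val_injective.comap_cofinite_eq, ← Function.comp_def f, ← tendsto_map'_iff,
    map_comap, Subtype.range_val]

end CofiniteFilters

namespace MrowkaSpace

variable {𝒜 : Set (Set ℕ)}

theorem nat_injective : Function.Injective (nat : ℕ → MrowkaSpace 𝒜) := fun _ _ h => nat.inj h

theorem nhds_nat (n : ℕ) : 𝓝 (nat n : MrowkaSpace 𝒜) = pure (nat n) :=
  (isOpen_singleton_iff_nhds_eq_pure _).1 fun _ h => nomatch h

theorem nhds_mem (A : 𝒜) :
    𝓝 (mem A) = pure (mem A) ⊔ map (nat : ℕ → MrowkaSpace 𝒜) (cofinite ⊓ 𝓟 A) := by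
  refine le_antisymm (fun V hV => ?_) (sup_le (pure_le_nhds _) fun V hV => ?_)
  · refine mem_nhds_iff.2 ⟨insert (mem A) (nat '' (nat ⁻¹' V)), ?_, ?_, mem_insert _ _⟩
    · exact insert_subset hV.1 (image_preimage_subset _ _)
    · rintro B (hB | ⟨n, -, hn⟩)
      · cases hB
        refine ⟨_, mem_inf_principal.1 hV.2, fun n hn => Or.inr ⟨n, by_contra fun hnV => ?_, rfl⟩⟩
        exact hn.2 fun h => hnV (h hn.1)
      · cases hn
  · obtain ⟨U, hUV, hU, hA⟩ := mem_nhds_iff.1 hV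
    obtain ⟨F, hF, hFU⟩ := hU A hA
    exact mem_inf_principal.2 (mem_of_superset hF.compl_mem_cofinite fun n hnF hnA =>
      hUV (hFU n ⟨hnA, hnF⟩))

theorem t2Space (h𝒜 : IsAlmostDisjoint 𝒜) : T2Space (MrowkaSpace 𝒜) := by
  have hmap (l : Filter ℕ) (hl : l ≤ cofinite) (x : MrowkaSpace 𝒜) :
      Disjoint (map nat l) (pure x) :=
    disjoint_pure_of_le_cofinite (nat_injective.tendsto_cofinite.mono_left hl) x
  refine t2Space_iff_disjoint_nhds.2 fun x y hxy => ?_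
  rcases x with n | A <;> rcases y with m | B <;>
    simp only [nhds_nat, nhds_mem, disjoint_sup_left, disjoint_sup_right, disjoint_pure_pure]
  · exact hxy
  · exact ⟨hxy, (hmap _ inf_le_left _).symm⟩
  · exact ⟨hxy, hmap _ inf_le_left _⟩
  · have hAB : (A : Set ℕ) ≠ B := fun h => hxy (congrArg mem (Subtype.ext h))
    refine ⟨⟨hxy, hmap _ inf_le_left _⟩, (hmap _ inf_le_left _).symm, ?_⟩
    rw [disjoint_map nat_injective, disjoint_cofinite_inf_principal_iff inf_le_left,
      compl_mem_cofinite_inf_principal]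
    exact h𝒜.2 A A.2 B B.2 hAB

instance : WeaklyLocallyCompactSpace (MrowkaSpace 𝒜) where
  exists_compact_mem_nhds x := by
    rcases x with n | A
    · exact ⟨{nat n}, isCompact_singleton, by rw [nhds_nat]; exact mem_singleton _⟩
    · have hlim : Tendsto (fun n : (A : Set ℕ) => (nat n : MrowkaSpace 𝒜)) cofinite
          (𝓝 (mem A)) := tendsto_subtype_cofinite_iff.2 (by rw [nhds_mem]; exact le_sup_right)
      refine ⟨_, hlim.isCompact_insert_range_of_cofinite, ?_⟩
      rw [nhds_mem, mem_sup, mem_map]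
      exact ⟨mem_insert _ _, mem_inf_of_right fun n hn => Or.inr ⟨⟨n, hn⟩, rfl⟩⟩

/-- The decomposition of `Ψ(𝒜)` as the disjoint union of `ω` and `𝒜`. -/
def equivSum : MrowkaSpace 𝒜 ≃ ℕ ⊕ 𝒜 where
  toFun
    | nat n => Sum.inl n
    | mem A => Sum.inr A
  invFun := Sum.elim nat mem
  left_inv x := by cases x <;> rfl
  right_inv x := by cases x <;> rfl

end MrowkaSpace

namespace FranklinSpace

variable {𝒜 : Set (Set ℕ)}

/-- The isolated point of `Φ(𝒜)` that corresponds to `n ∈ ω`. -/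
def natPoint (n : ℕ) : FranklinSpace 𝒜 := (MrowkaSpace.nat n : MrowkaSpace 𝒜)

/-- The point of `Φ(𝒜)` that corresponds to `A ∈ 𝒜`. -/
def memPoint (A : 𝒜) : FranklinSpace 𝒜 := (MrowkaSpace.mem A : MrowkaSpace 𝒜)

theorem natPoint_injective : Function.Injective (natPoint : ℕ → FranklinSpace 𝒜) :=
  OnePoint.coe_injective.comp MrowkaSpace.nat_injective

theorem natPoint_ne_memPoint (n : ℕ) (A : 𝒜) : natPoint n ≠ memPoint A := fun h =>
  nomatch OnePoint.coe_injective h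

theorem nhds_natPoint (n : ℕ) : 𝓝 (natPoint n : FranklinSpace 𝒜) = pure (natPoint n) := by
  rw [natPoint, OnePoint.nhds_coe_eq, MrowkaSpace.nhds_nat, map_pure]

theorem nhds_memPoint (A : 𝒜) : 𝓝 (memPoint A) = pure (memPoint A) ⊔
    map (natPoint : ℕ → FranklinSpace 𝒜) (cofinite ⊓ 𝓟 A) := by
  rw [memPoint, OnePoint.nhds_coe_eq, MrowkaSpace.nhds_mem, map_sup, map_pure, map_map]
  rfl

theorem tendsto_natPoint_memPoint (A : 𝒜) :
    Tendsto natPoint (cofinite ⊓ 𝓟 (A : Set ℕ)) (𝓝 (memPoint A)) := by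
  rw [nhds_memPoint]
  exact le_sup_right

theorem le_nhds_infty {F : Filter (FranklinSpace 𝒜)} (hF : F ≤ cofinite)
    (h : ∀ A : 𝒜, Disjoint F (map natPoint (cofinite ⊓ 𝓟 A))) : F ≤ 𝓝 OnePoint.infty := by
  refine le_nhds_of_unique_clusterPt fun x hx => by_contra fun hne => ?_
  obtain ⟨y, rfl⟩ := OnePoint.ne_infty_iff_exists.1 hne
  refine hx.neBot.ne (Disjoint.eq_bot ?_)
  rcases y with n | A
  · change Disjoint (𝓝 (natPoint n)) F
    rw [nhds_natPoint]
    exact (disjoint_pure_of_le_cofinite hF _).symm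
  · change Disjoint (𝓝 (memPoint A)) F
    rw [nhds_memPoint, disjoint_sup_left]
    exact ⟨(disjoint_pure_of_le_cofinite hF _).symm, (h A).symm⟩

theorem tendsto_natPoint_infty :
    Tendsto (natPoint : ℕ → FranklinSpace 𝒜) (cofinite ⊓ ⨅ A : 𝒜, 𝓟 (A : Set ℕ)ᶜ)
      (𝓝 OnePoint.infty) := by
  refine le_nhds_infty (natPoint_injective.tendsto_cofinite.mono_left inf_le_left) fun A => ?_
  rw [disjoint_map natPoint_injective, disjoint_cofinite_inf_principal_iff inf_le_left]
  exact mem_inf_of_right (mem_iInf_of_mem A (mem_principal_self _))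

theorem t2Space (h𝒜 : IsAlmostDisjoint 𝒜) : T2Space (FranklinSpace 𝒜) :=
  have := MrowkaSpace.t2Space h𝒜
  inferInstance

theorem separableSpace (h𝒜 : ∀ A ∈ 𝒜, A.Infinite) :
    TopologicalSpace.SeparableSpace (FranklinSpace 𝒜) := by
  refine ⟨insert OnePoint.infty (range natPoint), (countable_range _).insert _, fun x => ?_⟩
  induction x using OnePoint.rec with
  | infty => exact subset_closure (mem_insert _ _)
  | coe x =>
    rcases x with n | A
    · exact subset_closure (Or.inr ⟨n, rfl⟩)
    · have := (h𝒜 A A.2).cofinite_inf_principal_neBot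
      exact mem_closure_of_tendsto (tendsto_natPoint_memPoint A)
        (Eventually.of_forall fun n => Or.inr ⟨n, rfl⟩)

theorem mk_eq_continuum (h𝒜 : #𝒜 = 𝔠) : #(FranklinSpace 𝒜) = 𝔠 := by
  change #(Option (MrowkaSpace 𝒜)) = 𝔠
  rw [mk_option, MrowkaSpace.equivSum.cardinal_eq, mk_sum, mk_nat, h𝒜, lift_aleph0, lift_continuum,
    aleph0_add_continuum]
  exact add_eq_left aleph0_le_continuum (one_le_aleph0.trans aleph0_le_continuum)

theorem hasNiceFranklinSpace (h𝒜 : IsAlmostDisjoint 𝒜) (hcard : #𝒜 = 𝔠) :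
    HasNiceFranklinSpace 𝒜 :=
  ⟨infinite_coe_iff.1 (infinite_iff.2 (hcard ▸ aleph0_le_continuum)), h𝒜, t2Space h𝒜,
    inferInstance, separableSpace h𝒜.1, mk_eq_continuum hcard⟩

variable {Λ : Type*} {ρ : Set ℕ → Set Λ}

theorem finBWRho_of_forall_natPoint_comp [Countable Λ] (hρ : IsDiagonalizable ρ)
    (h : ∀ g : Λ → ℕ, HasTailLimitIn ρ (natPoint ∘ g : Λ → FranklinSpace 𝒜) (range 𝓝)) :
    FinBWRho ρ (FranklinSpace 𝒜) := by
  refine (finBWRho_iff_hasTailLimitIn hρ.monotone).2 fun f => ?_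
  let N : Set Λ := f ⁻¹' range natPoint
  obtain ⟨D, hD, _, ⟨x, rfl⟩, hx⟩ := h (Function.invFun (natPoint : ℕ → FranklinSpace 𝒜) ∘ f)
  obtain ⟨p, hpD, hp⟩ := hρ.exists_ultrafilter hD
  suffices ∃ l : Filter Λ, l.IsCountablyGenerated ∧ ↑p ≤ l ∧ ∃ x, Tendsto f l (𝓝 x) by
    obtain ⟨l, hl, hpl, x, hx⟩ := this
    obtain ⟨D', hD', hD'l⟩ := hp l hl hpl
    exact ⟨D', hD', 𝓝 x, mem_range_self x, hx.mono_left hD'l⟩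
  by_cases hN : N ∈ p
  · have := isCountablyGenerated_tailFilter hρ.monotone D
    refine ⟨tailFilter ρ D ⊓ 𝓟 N, inferInstance, le_inf hpD (le_principal_iff.2 hN), x, ?_⟩
    refine (hx.mono_left inf_le_left).congr' ?_
    filter_upwards [mem_inf_of_right (mem_principal_self N)] with y hy
    exact Function.invFun_eq hy
  rcases (p.map f).le_cofinite_or_eq_pure with hcof | ⟨x, hx⟩
  · have := isCountablyGenerated_comap_cofinite f
    have hpN : Nᶜ ∈ p := Ultrafilter.compl_mem_iff_notMem.2 hN
    refine ⟨comap f cofinite ⊓ 𝓟 Nᶜ, inferInstance,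
      le_inf (map_le_iff_le_comap.1 hcof) (le_principal_iff.2 hpN), OnePoint.infty,
      le_nhds_infty (tendsto_comap.mono_left inf_le_left) fun A => ?_⟩
    exact Filter.disjoint_iff.2 ⟨(range natPoint)ᶜ,
      mem_map.2 (mem_inf_of_right (mem_principal_self _)), range natPoint,
      mem_map.2 (univ_mem' mem_range_self), disjoint_compl_left⟩
  · have hpx : Tendsto f p (pure x) := (congrArg Ultrafilter.toFilter hx).le
    exact ⟨comap f (pure x), inferInstance, tendsto_iff_comap.1 hpx, x,
      tendsto_comap.mono_right (pure_le_nhds x)⟩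

theorem not_finBW {I : Set (Set ℕ)} (hI : IsIdealOn I) (h𝒜 : IsAlmostDisjoint 𝒜)
    (h𝒜I : 𝒜 ⊆ I) (h : ∀ A ∉ I, ∃ B ∈ 𝒜, B ⊆ A) : ¬ FinBW I (FranklinSpace 𝒜) := by
  intro hF
  obtain ⟨A, hA, x, hx⟩ := hF natPoint
  rw [tendsto_subtype_cofinite_iff] at hx
  obtain ⟨B, hB, hBA⟩ := h A hA
  have := t2Space h𝒜
  have := (h𝒜.1 B hB).cofinite_inf_principal_neBot
  obtain rfl : x = memPoint ⟨B, hB⟩ := tendsto_nhds_unique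
    (hx.mono_left (inf_le_inf_left _ (principal_mono.2 hBA))) (tendsto_natPoint_memPoint ⟨B, hB⟩)
  have hBmem : B ∈ cofinite ⊓ 𝓟 A := by
    have : natPoint ⁻¹' insert (memPoint ⟨B, hB⟩) (natPoint '' B) ∈ cofinite ⊓ 𝓟 A := hx <| by
      rw [nhds_memPoint]
      exact ⟨mem_insert _ _, mem_inf_of_right fun n hn => Or.inr (mem_image_of_mem _ hn)⟩
    filter_upwards [this] with n hn
    exact natPoint_injective.mem_set_image.1 (hn.resolve_left (natPoint_ne_memPoint n _))
  have hAB : (A \ B).Finite := compl_mem_cofinite_inf_principal.1 (by rwa [compl_compl] : Bᶜᶜ ∈ _)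
  refine hA (hI.subset_mem A _ ?_ (hI.union_mem _ _ (h𝒜I hB) (hI.finite_mem _ hAB)))
  exact union_sdiff_self.symm ▸ subset_union_right

end FranklinSpace

section Existence

variable {Λ Γ : Type*} {ρ : Set ℕ → Set Λ}

theorem IsIdealOn.compl_notMem {I : Set (Set Λ)} (hI : IsIdealOn I) {A : Set Λ} (hA : A ∈ I) :
    Aᶜ ∉ I := fun hA' => hI.univ_notMem (union_compl_self A ▸ hI.union_mem A Aᶜ hA hA')

theorem IsIdealOn.mk_compl_eq_continuum {I : Set (Set ℕ)} (hI : IsIdealOn I) :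
    #{A : Set ℕ // A ∉ I} = 𝔠 := by
  refine le_antisymm ((mk_subtype_le _).trans_eq mk_set_nat) (not_lt.1 fun hlt => ?_)
  have hle : #I ≤ #(Iᶜ : Set (Set ℕ)) := mk_le_of_injective
    (f := fun A : I => ⟨(A : Set ℕ)ᶜ, hI.compl_notMem A.2⟩) fun A A' h =>
      Subtype.ext (compl_injective (congrArg Subtype.val h))
  have hI : #(Iᶜᶜ : Set (Set ℕ)) = 𝔠 :=
    (mk_compl_of_infinite Iᶜ (hlt.trans_eq mk_set_nat.symm)).trans mk_set_nat
  rw [compl_compl] at hI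
  exact (hI ▸ hle).not_gt hlt

theorem exists_franklinSpace_finBWRho_not_finBW_nat (hCH : (ℵ₁ : Cardinal.{0}) = 𝔠) [Countable Λ]
    (hρ : IsDiagonalizable ρ) {I : Set (Set ℕ)} (hI : IsIdealOn I)
    (hK : ¬ KatetovLE I (idealOf ρ)) :
    ∃ 𝒜 : Set (Set ℕ), HasNiceFranklinSpace 𝒜 ∧ FinBWRho ρ (FranklinSpace 𝒜) ∧
      ¬ FinBW I (FranklinSpace 𝒜) := by
  obtain ⟨B, hB, hBdisj, hBlim⟩ := exists_almostDisjoint_forall_hasTailLimitIn hCH hρ hI hK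
  have hBinj : Function.Injective B := fun A A' h => by_contra fun hne =>
    (hB A).2.1 (by simpa only [← h, inter_self] using hBdisj A A' hne)
  have h𝒜 : IsAlmostDisjoint (range B) := by
    refine ⟨forall_mem_range.2 fun A => (hB A).2.1, ?_⟩
    rintro _ ⟨A, rfl⟩ _ ⟨A', rfl⟩ hne
    exact hBdisj A A' (ne_of_apply_ne B hne)
  refine ⟨range B, FranklinSpace.hasNiceFranklinSpace h𝒜 ?_,
    FranklinSpace.finBWRho_of_forall_natPoint_comp hρ fun g => (hBlim g).comp ?_,
    FranklinSpace.not_finBW hI h𝒜 (range_subset_iff.2 fun A => (hB A).2.2) fun A hA =>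
      ⟨B ⟨A, hA⟩, mem_range_self _, (hB ⟨A, hA⟩).1⟩⟩
  · rw [mk_range_eq B hBinj, hI.mk_compl_eq_continuum]
  · rintro _ (⟨n, rfl⟩ | rfl | ⟨A, rfl⟩)
    · exact ⟨_, mem_range_self _, (tendsto_pure_pure _ n).mono_right (pure_le_nhds _)⟩
    · refine ⟨_, mem_range_self _, FranklinSpace.tendsto_natPoint_infty.mono_left ?_⟩
      exact inf_le_inf_left _ (iInf_range' (fun A => 𝓟 (Aᶜ : Set ℕ)) B).ge
    · exact ⟨_, mem_range_self _, FranklinSpace.tendsto_natPoint_memPoint (⟨B A, A, rfl⟩ : range B)⟩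

theorem exists_franklinSpace_finBWRho_not_finBW (hCH : (ℵ₁ : Cardinal.{0}) = 𝔠) [Countable Λ]
    (hρ : IsDiagonalizable ρ) [Countable Γ] {I : Set (Set Γ)} (hI : IsIdealOn I)
    (hK : ¬ KatetovLE I (idealOf ρ)) :
    ∃ 𝒜 : Set (Set ℕ), HasNiceFranklinSpace 𝒜 ∧ FinBWRho ρ (FranklinSpace 𝒜) ∧
      ¬ FinBW I (FranklinSpace 𝒜) := by
  have : Infinite Γ := infinite_univ_iff.1 fun h => hI.univ_notMem (hI.finite_mem univ h)
  obtain ⟨e⟩ : Nonempty (Γ ≃ ℕ) := nonempty_equiv_of_countable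
  let J : Set (Set ℕ) := {A | e ⁻¹' A ∈ I}
  have hJ : IsIdealOn J :=
    { subset_mem := fun A B hAB hB => hI.subset_mem _ _ (preimage_mono hAB) hB
      union_mem := fun A B hA hB => hI.union_mem _ _ hA hB
      univ_notMem := hI.univ_notMem
      finite_mem := fun A hA => hI.finite_mem _ (hA.preimage e.injective.injOn) }
  have hKJ : ¬ KatetovLE J (idealOf ρ) := fun ⟨φ, hφ⟩ =>
    hK ⟨e.symm ∘ φ, fun A hA hmem => hφ A hA (by
      rwa [image_comp, Equiv.image_symm_eq_preimage] at hmem)⟩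
  obtain ⟨𝒜, hnice, hFinBWRho, hFinBW⟩ :=
    exists_franklinSpace_finBWRho_not_finBW_nat hCH hρ hJ hKJ
  refine ⟨𝒜, hnice, hFinBWRho, fun hF => hFinBW fun f => ?_⟩
  obtain ⟨A, hA, x, hx⟩ := hF (f ∘ e)
  refine ⟨e '' A, fun hmem => hA ?_, x, ?_⟩
  · rwa [mem_ofPred_eq, preimage_image_eq _ e.injective] at hmem
  · rw [tendsto_subtype_cofinite_iff (f := f ∘ e), ← tendsto_map'_iff] at hx
    refine tendsto_subtype_cofinite_iff.2 (hx.mono_left ?_)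
    rw [map_inf e.injective, map_principal]
    exact inf_le_inf_right _ e.surjective.le_map_cofinite

end Existence

section SummableIdeal

theorem mem_summableIdeal_iff {A : Set ℕ} :
    A ∈ summableIdeal ↔ Summable (A.indicator fun n : ℕ => 1 / ((n : ℝ) + 1)) :=
  summable_subtype_iff_indicator (f := fun n : ℕ => 1 / ((n : ℝ) + 1))

theorem isIdealOn_summableIdeal : IsIdealOn summableIdeal where
  subset_mem A B hAB hB := by
    rw [← inter_eq_self_of_subset_left hAB, mem_summableIdeal_iff, ← indicator_indicator]
    exact (mem_summableIdeal_iff.1 hB).indicator A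
  union_mem A B hA hB := by
    rw [mem_summableIdeal_iff] at hA hB ⊢
    have hBA := hB.indicator Aᶜ
    rw [indicator_indicator, inter_comm, ← sdiff_eq] at hBA
    rw [← union_sdiff_self, indicator_union_of_disjoint disjoint_sdiff_right]
    exact hA.add hBA
  univ_notMem h := by
    rw [mem_summableIdeal_iff, indicator_univ] at h
    exact Real.not_summable_one_div_natCast ((summable_nat_add_iff 1).1 (by simpa using h))
  finite_mem A hA := by
    have := hA.to_subtype
    exact Summable.of_finite

/-- The finite values `m` that the sequence `c` takes at some index `k` with `2 ^ k ≤ m`. -/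
def sparseValues (c : ℕ → ℕ∞) : Set ℕ := {m | ∃ k, c k = m ∧ 2 ^ k ≤ m}

theorem sparseValues_mem_summableIdeal (c : ℕ → ℕ∞) : sparseValues c ∈ summableIdeal := by
  choose k hck hk using fun m : sparseValues c => m.2
  have hinj : Function.Injective k := fun m m' h => by
    have hm := hck m
    rw [h, hck m'] at hm
    exact Subtype.ext (Nat.cast_injective hm).symm
  refine (summable_geometric_two.comp_injective hinj).of_nonneg_of_le
    (fun m => by positivity) fun m => ?_
  have hle : (2 : ℝ) ^ k m ≤ ((m : ℕ) : ℝ) + 1 := by exact_mod_cast (hk m).trans (Nat.le_succ _)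
  rw [Function.comp_apply, one_div_pow]
  exact one_div_le_one_div_of_le (by positivity) hle

end SummableIdeal

section Canonization

theorem eventually_eq_or_le_of_tendsto_nhds {Λ : Type*} {l : Filter Λ} {f : Λ → ℕ∞} {a : ℕ∞}
    (h : Tendsto f l (𝓝 a)) (b : ℕ) : ∀ᶠ x in l, f x = a ∨ b ≤ f x := by
  cases a with
  | top => exact (ENat.tendsto_nhds_top_iff_natCast_lt.1 h b).mono fun x hx => Or.inr hx.le
  | coe a =>
    rw [ENat.nhds_natCast, tendsto_pure] at h
    exact h.mono fun x hx => Or.inl hx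

theorem mem_sparseValues_of_two_pow_le {c : Finset ℕ → ℕ∞} {γ : Finset ℕ} {n m : ℕ}
    (hγ : ∀ i ∈ γ, i < n) (hle : ((2 ^ 2 ^ n : ℕ) : ℕ∞) ≤ c γ) (hm : c γ = m) :
    m ∈ sparseValues (c ∘ Finset.equivBitIndices) := by
  have hcode : Finset.equivBitIndices.symm γ < 2 ^ n := Nat.geomSum_lt le_rfl hγ
  refine ⟨Finset.equivBitIndices.symm γ, by rwa [Function.comp_apply, Equiv.apply_symm_apply], ?_⟩
  rw [hm, Nat.cast_le] at hle
  exact (Nat.pow_le_pow_right two_pos hcode.le).trans hle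

theorem of_forall_insert_eq_or {X : Type*} {φ ψ : Finset ℕ → X} {N : ℕ∞} {P : X → Prop}
    (hempty : P (ψ ∅)) (hinsert : ∀ n, ∀ γ ⊆ Finset.range n, γ.card < N →
      ∀ χ ∈ ({φ, ψ} : Set (Finset ℕ → X)), χ (insert n γ) = ψ γ ∨ P (χ (insert n γ)))
    (γ : Finset ℕ) (hγN : γ.card ≤ N) : (γ.Nonempty → P (φ γ)) ∧ P (ψ γ) := by
  induction γ using Finset.induction_on_max with
  | empty => exact ⟨fun h => absurd h Finset.not_nonempty_empty, hempty⟩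
  | insert n γ hγ ih =>
    rw [Finset.card_insert_of_notMem fun hn => (hγ n hn).false, Nat.cast_succ] at hγN
    have hlt : (γ.card : ℕ∞) < N := (ENat.add_one_le_iff (ENat.natCast_ne_top _)).1 hγN
    have hP {χ : Finset ℕ → X} (hχ : χ ∈ ({φ, ψ} : Set _)) : P (χ (insert n γ)) :=
      (hinsert n γ (fun i hi => Finset.mem_range.2 (hγ i hi)) hlt χ hχ).elim
        (fun heq => heq ▸ (ih hlt.le).2) id
    exact ⟨fun _ => hP (mem_insert _ _), hP (mem_insert_of_mem _ rfl)⟩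

theorem setOf_eq_natCast_mem_summableIdeal {φ ψ : Finset ℕ → ℕ∞} {N : ℕ∞}
    (h : ∀ n, ∀ γ ⊆ Finset.range n, γ.card < N → ∀ χ ∈ ({φ, ψ} : Set (Finset ℕ → ℕ∞)),
      χ (insert n γ) = ψ γ ∨ ((2 ^ 2 ^ (n + 1) : ℕ) : ℕ∞) ≤ χ (insert n γ)) :
    {m : ℕ | ∃ γ : Finset ℕ, γ.Nonempty ∧ γ.card ≤ N ∧ φ γ = m} ∈ summableIdeal := by
  let sparse (χ : Finset ℕ → ℕ∞) : Set ℕ := sparseValues (χ ∘ Finset.equivBitIndices)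
  let S : Set ℕ := {m | ψ ∅ = m} ∪ (sparse φ ∪ sparse ψ)
  have hI := isIdealOn_summableIdeal
  have hS : S ∈ summableIdeal := by
    refine hI.union_mem _ _ (hI.finite_mem _ (Set.Subsingleton.finite fun m hm m' hm' => ?_))
      (hI.union_mem _ _ (sparseValues_mem_summableIdeal _) (sparseValues_mem_summableIdeal _))
    exact Nat.cast_injective (hm.symm.trans hm')
  have hsparse : ∀ χ ∈ ({φ, ψ} : Set (Finset ℕ → ℕ∞)), sparse χ ⊆ S := by
    rintro _ (rfl | rfl)
    exacts [subset_union_left.trans subset_union_right, subset_union_right.trans subset_union_right]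
  refine hI.subset_mem _ _ (fun m ⟨γ, hγ, hγN, hm⟩ => ?_) hS
  refine (of_forall_insert_eq_or (φ := φ) (ψ := ψ)
    (P := fun y => ∀ m : ℕ, y = m → m ∈ S) (fun _ => Or.inl)
    (fun n γ hγ hγN χ hχ => ?_) γ hγN).1 hγ m hm
  refine (h n γ hγ hγN χ hχ).imp_right fun hle m hm =>
    hsparse χ hχ (mem_sparseValues_of_two_pow_le (fun i hi => ?_) hle hm)
  rw [← Finset.mem_range, Finset.range_add_one]
  exact Finset.insert_subset_insert n hγ hi

theorem exists_infinite_setOf_eq_natCast_mem_summableIdeal {v : Filter ℕ} [v.NeBot]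
    (hv : v ≤ cofinite) {φ ψ : Finset ℕ → ℕ∞} {N : ℕ∞}
    (h : ∀ α : Finset ℕ, α.card < N → ∀ χ ∈ ({φ, ψ} : Set (Finset ℕ → ℕ∞)),
      Tendsto (fun x => χ (insert x α)) v (𝓝 (ψ α))) :
    ∃ D : Set ℕ, D.Infinite ∧ {m : ℕ | ∃ α : Finset ℕ, α.Nonempty ∧ (α : Set ℕ) ⊆ D ∧
      α.card ≤ N ∧ φ α = m} ∈ summableIdeal := by
  obtain ⟨d, hd, hstable⟩ := exists_strictMono_forall_image hv
    (R := fun n α x => α.card < N → ∀ χ ∈ ({φ, ψ} : Set (Finset ℕ → ℕ∞)),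
      χ (insert x α) = ψ α ∨ ((2 ^ 2 ^ (n + 1) : ℕ) : ℕ∞) ≤ χ (insert x α)) fun n α =>
      eventually_imp_distrib_left.2 fun hα => (eventually_all_finite (toFinite _)).2 fun χ hχ =>
        eventually_eq_or_le_of_tendsto_nhds (h α hα χ hχ) _
  have hcard (γ : Finset ℕ) : (γ.image d).card = γ.card :=
    Finset.card_image_of_injective γ hd.injective
  refine ⟨range d, infinite_range_of_injective hd.injective,
    isIdealOn_summableIdeal.subset_mem _ _ ?_ (setOf_eq_natCast_mem_summableIdeal (N := N)
      (φ := fun γ => φ (γ.image d)) (ψ := fun γ => ψ (γ.image d)) fun n γ hγ hγN => ?_)⟩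
  · rintro m ⟨α, hα, hαd, hαN, hm⟩
    rw [← image_univ] at hαd
    obtain ⟨γ, -, rfl⟩ := Finset.subset_set_image_iff.1 hαd
    exact ⟨γ, Finset.image_nonempty.1 hα, by rwa [← hcard], hm⟩
  · have hn := hstable n γ hγ (by rwa [hcard])
    rintro _ (rfl | rfl) <;> simp only [Finset.image_insert]
    exacts [hn φ (mem_insert _ _), hn ψ (mem_insert_of_mem _ rfl)]

theorem tendsto_ultrafilter_lim {Λ X : Type*} [TopologicalSpace X] [CompactSpace X]
    (p : Ultrafilter Λ) (f : Λ → X) : Tendsto f p (𝓝 (p.map f).lim) :=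
  (p.map f).le_nhds_lim

theorem exists_extend_tendsto_insert {v : Ultrafilter ℕ} (hv : (v : Filter ℕ) ≤ cofinite)
    {X : Type*} [TopologicalSpace X] [CompactSpace X] (φ : Finset ℕ → X) (n : ℕ) :
    ∃ χ : Finset ℕ → X, (∀ α, α.card = n → χ α = φ α) ∧
      ∀ α, α.card < n → Tendsto (fun x => χ (insert x α)) v (𝓝 (χ α)) := by
  let lim (χ : Finset ℕ → X) (α : Finset ℕ) : X := (v.map fun x => χ (insert x α)).lim
  refine ⟨fun α => lim^[n - α.card] φ α, fun α hα => ?_, fun α hα => ?_⟩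
  · simp only [hα, Nat.sub_self, Function.iterate_zero, id]
  · have hsub : n - α.card = n - (α.card + 1) + 1 := by omega
    simp only [hsub, Function.iterate_succ_apply']
    refine (tendsto_ultrafilter_lim v _).congr' ?_
    filter_upwards [hv α.finite_toSet.compl_mem_cofinite] with x hx
    rw [Finset.card_insert_of_notMem hx]

end Canonization

section NotKatetov

theorem not_katetovLE_idealOf {Λ Γ : Type*} {ρ : Set ℕ → Set Λ} {I : Set (Set Γ)}
    (h : ∀ φ : Λ → Γ, ∃ D : Set ℕ, D.Infinite ∧ φ '' ρ D ∈ I) : ¬ KatetovLE I (idealOf ρ) := by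
  rintro ⟨φ, hφ⟩
  obtain ⟨D, hD, hφD⟩ := h φ
  exact hφ (ρ D) (fun hmem => hmem D hD subset_rfl) hφD

theorem exists_image_pairsOf_mem_summableIdeal (φ : NatPair → ℕ) :
    ∃ D : Set ℕ, D.Infinite ∧ φ '' pairsOf D ∈ summableIdeal := by
  obtain ⟨v, hv, -⟩ := exists_ultrafilter_le_cofinite_inf_principal infinite_univ
  obtain ⟨χ, hχφ, hχ⟩ := exists_extend_tendsto_insert hv
    (Function.extend Subtype.val (fun s => (φ s : ℕ∞)) ⊤) 2
  obtain ⟨D, hD, hDφ⟩ := exists_infinite_setOf_eq_natCast_mem_summableIdeal hv (φ := χ) (ψ := χ)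
    (N := 2) fun α hα => by
      simpa only [pair_eq_singleton, forall_eq, mem_singleton_iff] using hχ α (by exact_mod_cast hα)
  refine ⟨D, hD, isIdealOn_summableIdeal.subset_mem _ _ ?_ hDφ⟩
  rintro _ ⟨s, hsD, rfl⟩
  refine ⟨s, Finset.card_pos.1 (s.2.symm ▸ two_pos), hsD, by rw [s.2]; rfl, ?_⟩
  rw [hχφ s s.2, Subtype.val_injective.extend_apply]

theorem tendsto_map_add_lim {U : Ultrafilter ℕ}
    (hUU : ∀ P : ℕ → Prop, (∀ᶠ m in U, P m) ↔ ∀ᶠ m in U, ∀ᶠ n in U, P (m + n))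
    {X : Type*} [TopologicalSpace X] [RegularSpace X] {f : ℕ → X} {L : ℕ → X}
    (hL : ∀ m, Tendsto (fun n => f (m + n)) U (𝓝 (L m))) (m : ℕ) :
    Tendsto (fun n => L (m + n)) U (𝓝 (L m)) := by
  refine (closed_nhds_basis (L m)).tendsto_right_iff.2 fun V ⟨hV, hVc⟩ => ?_
  filter_upwards [(hUU _).1 (hL m hV)] with n hn
  exact hVc.mem_of_tendsto (hL (m + n)) (by simpa only [add_assoc] using hn)

theorem exists_image_finiteSums_mem_summableIdeal (φ : ℕ → ℕ) :
    ∃ D : Set ℕ, D.Infinite ∧ φ '' finiteSums D ∈ summableIdeal := by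
  obtain ⟨U, hUE, hUU⟩ := exists_idempotent_ultrafilter_le_tailFilter infinite_univ
  have hU := hUE.trans (tailFilter_finiteSums_le_cofinite univ)
  let L (m : ℕ) : ℕ∞ := (U.map fun n => (φ (m + n) : ℕ∞)).lim
  have hφL (m : ℕ) : Tendsto (fun n => (φ (m + n) : ℕ∞)) U (𝓝 (L m)) :=
    tendsto_ultrafilter_lim U _
  obtain ⟨D, hD, hDφ⟩ := exists_infinite_setOf_eq_natCast_mem_summableIdeal hU (N := ⊤)
    (φ := fun α => φ (∑ i ∈ α, i)) (ψ := fun α => L (∑ i ∈ α, i)) fun α _ => by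
      have hsum := (eventually_sum_insert hU α).mono fun x hx => hx.symm
      rintro _ (rfl | rfl)
      · exact (hφL _).congr' (hsum.mono fun x hx => by rw [hx])
      · exact (tendsto_map_add_lim (f := fun n => (φ n : ℕ∞)) hUU hφL _).congr'
          (hsum.mono fun x hx => by rw [hx])
  refine ⟨D, hD, isIdealOn_summableIdeal.subset_mem _ _ ?_ hDφ⟩
  rintro _ ⟨_, ⟨α, hα, hαD, rfl⟩, rfl⟩
  exact ⟨α, hα, hαD, le_top, rfl⟩

theorem exists_image_posDifferences_mem_summableIdeal (φ : ℕ → ℕ) :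
    ∃ D : Set ℕ, D.Infinite ∧ φ '' posDifferences D ∈ summableIdeal := by
  simpa only [posDifferences_eq_image, image_comp] using
    exists_image_pairsOf_mem_summableIdeal (φ ∘ pairDifference)

end NotKatetov

theorem mainTheorem5 (hCH : (ℵ₁ : Cardinal.{0}) = 𝔠) :
    (∀ (Λ : Type*) [Countable Λ] [Infinite Λ] (I : Set (Set Λ)), IsIdealOn I →
      (¬ KatetovLE I hindmanIdeal → ∃ 𝒜 : Set (Set ℕ), HasNiceFranklinSpace 𝒜 ∧
        IsHindmanSpace (FranklinSpace 𝒜) ∧ ¬ FinBW I (FranklinSpace 𝒜)) ∧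
      (¬ KatetovLE I ramseyIdeal → ∃ 𝒜 : Set (Set ℕ), HasNiceFranklinSpace 𝒜 ∧
        IsRamseySpace (FranklinSpace 𝒜) ∧ ¬ FinBW I (FranklinSpace 𝒜)) ∧
      (¬ KatetovLE I differenceIdeal → ∃ 𝒜 : Set (Set ℕ), HasNiceFranklinSpace 𝒜 ∧
        IsDifferentiallyCompact (FranklinSpace 𝒜) ∧ ¬ FinBW I (FranklinSpace 𝒜))) ∧
    (∃ 𝒜 : Set (Set ℕ), HasNiceFranklinSpace 𝒜 ∧
      IsHindmanSpace (FranklinSpace 𝒜) ∧ ¬ FinBW summableIdeal (FranklinSpace 𝒜)) ∧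
    (∃ 𝒜 : Set (Set ℕ), HasNiceFranklinSpace 𝒜 ∧
      IsRamseySpace (FranklinSpace 𝒜) ∧ ¬ FinBW summableIdeal (FranklinSpace 𝒜)) ∧
    (∃ 𝒜 : Set (Set ℕ), HasNiceFranklinSpace 𝒜 ∧
      IsDifferentiallyCompact (FranklinSpace 𝒜) ∧
        ¬ FinBW summableIdeal (FranklinSpace 𝒜)) := by
  have : Countable NatPair := Subtype.countable
  have hsummable {Λ : Type} [Countable Λ] {ρ : Set ℕ → Set Λ} (hρ : IsDiagonalizable ρ)
      (h : ∀ φ : Λ → ℕ, ∃ D : Set ℕ, D.Infinite ∧ φ '' ρ D ∈ summableIdeal) :=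
    exists_franklinSpace_finBWRho_not_finBW hCH hρ isIdealOn_summableIdeal (not_katetovLE_idealOf h)
  exact ⟨fun Λ _ _ I hI =>
    ⟨exists_franklinSpace_finBWRho_not_finBW hCH isDiagonalizable_finiteSums hI,
      exists_franklinSpace_finBWRho_not_finBW hCH isDiagonalizable_pairsOf hI,
      exists_franklinSpace_finBWRho_not_finBW hCH isDiagonalizable_posDifferences hI⟩,
    hsummable isDiagonalizable_finiteSums exists_image_finiteSums_mem_summableIdeal,
    hsummable isDiagonalizable_pairsOf exists_image_pairsOf_mem_summableIdeal,
    hsummable isDiagonalizable_posDifferences exists_image_posDifferences_mem_summableIdeal⟩
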